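/- Let $L$ be a first-order language, let $\kappa>|L|+\aleph_0$, and let $\mathbb M$ be a monster model of an arbitrary (complete) $L$-theory, i.e. a $\kappa$-saturated, strongly $\kappa$-homogeneous $L$-structure. All sets and tuples below are small, i.e. of size $<\kappa$; tuples are identified with the sets they enumerate, and $AB$ means $A\cup B$. Write $A\perp^d_C B$ (resp. $A\perp^f_C B$) if $\mathrm{tp}(A/CB)$ does not divide (resp. fork) over $C$; $A\perp^u_C B$ if $\mathrm{tp}(A/CB)$ is finitely satisfiable in $C$; and $A\perp^a_C B$ if $\mathrm{acl}(CA)\cap\mathrm{acl}(CB)=\mathrm{acl}(C)$. For a ternary relation $\perp$ on small subsets of $\mathbb M$, its monotonisation $\perp^m$ is defined by $$A\perp^m_C B\iff A\perp_{CD}BC\ \text{ for all } D\subseteq CB .$$ A relation $\perp$ satisfies *extension over* $C$ if $A\perp_C B$ implies that for every $D$ there is $A'\equiv_{CB}A$ with $A'\perp_C BD$. Let $\perp$ be a ternary relation such that: 1. $\perp$ is weaker than $\perp^d$: $A\perp^d_C B$ implies $A\perp_C B$, for all $A,B,C$. 2. $\perp$ satisfies - invariance: if $ABC\equiv A'B'C'$,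 then $A\perp_C B\iff A'\perp_{C'}B'$; - monotonicity: $A\perp_C BD$ implies $A\perp_C B$; - $\perp^u$-amalgamation over algebraically closed sets: for every algebraically closed $E$, all tuples $c_1\equiv_E c_2$ and all sets $A,B$ with $A\perp^u_E B$, $c_1\perp_E A$ and $c_2\perp_E B$, there is $c$ such that $c\perp_E AB$, $c\equiv_{EA}c_1$, $c\equiv_{EB}c_2$, $A\perp^a_{Ec}B$, $c\perp^a_{EA}B$ and $c\perp^a_{EB}A$. Then the following hold. - If $\perp^m$ satisfies extension over every algebraically closed set, then $\perp^m=\perp^f=\perp^d$ over algebraically closed sets: for all $A,B$ and every algebraically closed $C$, $$A\perp^m_C B\iff A\perp^f_C B\iff A\perp^d_C B .$$ - If $\perp^m$ satisfies extension over every set, then these equivalences hold for all $A,B,C$. -/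

import Mathlib

open FirstOrder Cardinal

universe u v w

namespace ModelIndep


section Basics

variable (L : FirstOrder.Language.{u, v}) {M : Type w} [L.Structure M]

/-- `a ≡_C a'`: the tuples `a` and `a'` (indexed by the same set) have the same type over `C`. -/
def SameType (C : Set M) {ι : Type*} (a a' : ι → M) : Prop :=
  ∀ φ : L[[C]].Formula ι, φ.Realize a ↔ φ.Realize a'

/-- `M` is `κ`-saturated: every set of formulas in fewer than `κ` variables, over fewer than `κ`
parameters, which is finitely satisfiable in `M` is realised in `M`. -/
def Saturated (M : Type w) [L.Structure M] (κ : Cardinal.{w}) : Prop :=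
  ∀ (C : Set M) (ι : Type w), #C < κ → #ι < κ →
    ∀ p : Set (L[[C]].Formula ι),
      (∀ p₀ : Finset (L[[C]].Formula ι), (p₀ : Set (L[[C]].Formula ι)) ⊆ p →
        ∃ a : ι → M, ∀ φ ∈ p₀, φ.Realize a) →
      ∃ a : ι → M, ∀ φ ∈ p, φ.Realize a

/-- `M` is strongly `κ`-homogeneous: every partial elementary map with domain of size less than
`κ` extends to an automorphism. -/
def StronglyHomogeneous (M : Type w) [L.Structure M] (κ : Cardinal.{w}) : Prop :=
  ∀ (C : Set M) (f : C → M), #C < κ → SameType L (∅ : Set M) (fun x : C => (x : M)) f →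
    ∃ σ : M ≃[L] M, ∀ x : C, σ x = f x

/-- `M` is a monster (big) model with respect to `κ`; the small sets are those of size `< κ`. -/
structure IsMonster (M : Type w) [L.Structure M] (κ : Cardinal.{w}) : Prop where
  aleph0_lt : ℵ₀ < κ
  card_lt : Cardinal.lift.{w} L.card < Cardinal.lift.{max u v} κ
  saturated : Saturated L M κ
  stronglyHomogeneous : StronglyHomogeneous L M κ

/-- The model-theoretic algebraic closure of `C`: the union of the finite `C`-definable sets. -/
def acl (C : Set M) : Set M :=
  {x | ∃ S : Set M, C.Definable₁ L S ∧ S.Finite ∧ x ∈ S}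

/-- `C` is algebraically closed. -/
def AclClosed (C : Set M) : Prop := acl L C = C

/-- `(s i)_{i < ω}` is a `C`-indiscernible sequence of `n`-tuples. -/
def Indiscernible (C : Set M) {n : ℕ} (s : ℕ → Fin n → M) : Prop :=
  ∀ (k : ℕ) (f g : Fin k ↪o ℕ),
    SameType L C (fun p : Fin k × Fin n => s (f p.1) p.2)
      (fun p : Fin k × Fin n => s (g p.1) p.2)

/-- The formula `φ(x, b)` (with `x` the tuple of variables indexed by `α`) divides over `C`: there
is a `C`-indiscernible sequence `(b_i)_{i < ω}` with `b_0 = b` such that `{φ(x, b_i) : i < ω}` is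
inconsistent. -/
def Divides (C : Set M) {α : Type w} {n : ℕ} (φ : L.Formula (α ⊕ Fin n)) (b : Fin n → M) : Prop :=
  ∃ s : ℕ → Fin n → M, s 0 = b ∧ Indiscernible L C s ∧
    ¬ ∃ a : α → M, ∀ i, φ.Realize (Sum.elim a (s i))

/-- The formula `φ(x, b)` forks over `C`: it implies a finite disjunction of formulas each of
which divides over `C`. -/
def Forks (C : Set M) {α : Type w} {n : ℕ} (φ : L.Formula (α ⊕ Fin n)) (b : Fin n → M) : Prop :=
  ∃ (k : ℕ) (m : Fin k → ℕ) (ψ : ∀ j, L.Formula (α ⊕ Fin (m j))) (d : ∀ j, Fin (m j) → M),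
    (∀ j, Divides L C (ψ j) (d j)) ∧
    ∀ a : α → M, φ.Realize (Sum.elim a b) → ∃ j, (ψ j).Realize (Sum.elim a (d j))

end Basics

/-- Ternary relations between subsets of `M`: `R A C B` is read `A ⫝_C B`, so the base set is the
middle argument. A tuple is identified with its range. Only the restriction of the relation to
small sets matters below. -/
abbrev TernaryRel (M : Type w) : Type w := Set M → Set M → Set M → Prop

section Relations

variable (L : FirstOrder.Language.{u, v}) {M : Type w} [L.Structure M]

/-- `A ⫝^d_C B`: no formula of `tp(A / C ∪ B)` divides over `C`. -/
def dividingIndep : TernaryRel M := fun A C B =>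
  ∀ (n : ℕ) (φ : L.Formula (A ⊕ Fin n)) (b : Fin n → M), (∀ i, b i ∈ C ∪ B) →
    φ.Realize (Sum.elim (fun x : A => (x : M)) b) → ¬ Divides L C φ b

/-- `A ⫝^f_C B`: no formula of `tp(A / C ∪ B)` forks over `C`. -/
def forkingIndep : TernaryRel M := fun A C B =>
  ∀ (n : ℕ) (φ : L.Formula (A ⊕ Fin n)) (b : Fin n → M), (∀ i, b i ∈ C ∪ B) →
    φ.Realize (Sum.elim (fun x : A => (x : M)) b) → ¬ Forks L C φ b

/-- `A ⫝^u_C B`: `tp(A / C ∪ B)` is finitely satisfiable in `C`. -/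
def coheirIndep : TernaryRel M := fun A C B =>
  ∀ (n : ℕ) (a : Fin n → M), (∀ i, a i ∈ A) →
    ∀ φ : L[[(C ∪ B : Set M)]].Formula (Fin n), φ.Realize a →
      ∃ c : Fin n → M, (∀ i, c i ∈ C) ∧ φ.Realize c

/-- `A ⫝^a_C B`: `acl(CA) ∩ acl(CB) = acl(C)`. -/
def algIndep : TernaryRel M := fun A C B =>
  acl L (C ∪ A) ∩ acl L (C ∪ B) = acl L C

/-- The monotonised `⫝^m` of `⫝`: `A ⫝^m_C B` iff `A ⫝_{CD} BC` for every `D ⊆ CB`. -/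
def monotonised (R : TernaryRel M) : TernaryRel M := fun A C B =>
  ∀ D : Set M, D ⊆ C ∪ B → R A (C ∪ D) (B ∪ C)

/-- Invariance: if `abc ≡ a'b'c'` then `a ⫝_c b` iff `a' ⫝_{c'} b'`. -/
def Invariance (κ : Cardinal.{w}) (R : TernaryRel M) : Prop :=
  ∀ (ι₁ ι₂ ι₃ : Type w), #ι₁ < κ → #ι₂ < κ → #ι₃ < κ →
    ∀ (a a' : ι₁ → M) (b b' : ι₂ → M) (c c' : ι₃ → M),
      SameType L (∅ : Set M) (Sum.elim a (Sum.elim b c)) (Sum.elim a' (Sum.elim b' c')) →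
      (R (Set.range a) (Set.range c) (Set.range b) ↔
        R (Set.range a') (Set.range c') (Set.range b'))

/-- Monotonicity: `A ⫝_C BD` implies `A ⫝_C B`. -/
def Monotonicity (κ : Cardinal.{w}) (R : TernaryRel M) : Prop :=
  ∀ A B C D : Set M, #A < κ → #B < κ → #C < κ → #D < κ → R A C (B ∪ D) → R A C B

/-- Extension over the base set `C`: if `A ⫝_C B` then for every `D` there is `A' ≡_{CB} A` with
`A' ⫝_C BD`. -/
def ExtensionOver (κ : Cardinal.{w}) (R : TernaryRel M) (C : Set M) : Prop :=
  ∀ A B D : Set M, #A < κ → #B < κ → #D < κ → R A C B →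
    ∃ a' : A → M, SameType L (C ∪ B) a' (fun x : A => (x : M)) ∧ R (Set.range a') C (B ∪ D)

/-- `⫝'`-amalgamation of `⫝` over the base set `E`. -/
def AmalgamationOver (κ : Cardinal.{w}) (R' R : TernaryRel M) (E : Set M) : Prop :=
  ∀ (ι : Type w) (c₁ c₂ : ι → M) (A B : Set M), #ι < κ → #A < κ → #B < κ →
    SameType L E c₁ c₂ → R' A E B → R (Set.range c₁) E A → R (Set.range c₂) E B →
    ∃ c : ι → M, R (Set.range c) E (A ∪ B) ∧
      SameType L (E ∪ A) c c₁ ∧ SameType L (E ∪ B) c c₂ ∧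
      algIndep L A (E ∪ Set.range c) B ∧
      algIndep L (Set.range c) (E ∪ A) B ∧
      algIndep L (Set.range c) (E ∪ B) A

end Relations

end ModelIndep

/-!
The only substantial implication is that `⫝^m` implies `⫝^d` over a small set `C` over which `⫝^m`
has extension (`dividingIndep_of_monotonised`). The remaining ones are formal: a formula that
divides over `C ∪ D` divides over `C`, so `⫝^d` is base monotone and, being stronger than `R`,
implies `⫝^m`; `⫝^f` implies `⫝^d` by definition; and since `⫝^m` implies `⫝^d` and has extension,
it implies `⫝^f`.

Let `A ⫝^m_C B`, let `φ(x, b)` be a formula of `tp(A / CB)`, and let `(s_i)` be a `C`-indiscernible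
sequence with `s_0 = b`. By saturation there is a sequence `(x_i)` such that `s_0, s_1, …, x_1, x_0`
is `C`-indiscernible of order type `ω + ω*` (`IsMonster.exists_indiscernibleOn`). Let `E` be the
algebraic closure of `C` and all the `x_i`. An indiscernible sequence over a set is
indiscernible over its algebraic closure, at least as far as types of single members are concerned
(`sameType_acl_of_pairs`). This gives both that the `s_i` have the same type over `E` and that
`s_{m+1} ⫝^u_E s_0 … s_m`, because `s_{m+1}` cannot be told apart from `x_K`, for large `K`, by
a formula over the algebraic closure of `C`, `s_0, …, s_m` and finitely many of the `x_i`.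

By extension of `⫝^m` there is `A' ≡_{CB} A` with `A' ⫝^m_C B E`, and the definition of `⫝^m`, with
`D = E`, makes `A'` independent from `s_0` over `E` in the sense of `R`. Moving `A'` by
automorphisms over `E` that take `s_0` to `s_i`, and amalgamating step by step, one finds for
every `m` a tuple that is `R`-independent from `s_0 … s_m` over `E` and satisfies `φ(x, s_i)` for all
`i ≤ m`. So `{φ(x, s_i) : i < ω}` is consistent, and `φ(x, b)` does not divide over `C`.

That `E` is algebraically closed and small, as amalgamation requires, is `acl_acl` and `mk_acl_lt`.
-/

namespace ModelIndep

/-! ### Definable sets and types -/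

section Definability

variable {L : FirstOrder.Language.{u, v}} {M : Type w} [L.Structure M]

open Set

/-- Parameters can be turned into variables: a set definable over `C ∪ range w` is the fibre at `w`
of a `C`-definable set. -/
lemma definable_union_range_iff {γ β : Type*} {C : Set M} {w : γ → M} {T : Set (β → M)} :
    (C ∪ range w).Definable L T ↔
      ∃ T' : Set (γ ⊕ β → M), C.Definable L T' ∧ T = {v | Sum.elim w v ∈ T'} := by
  constructor
  · rw [definable_iff_exists_formula_sum]
    rintro ⟨φ, rfl⟩
    have hp : ∀ p : ↥(C ∪ range w), ∃ q : C ⊕ γ, Sum.elim (fun x : C => (x : M)) w q = p := by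
      rintro ⟨p, hp | ⟨c, rfl⟩⟩
      · exact ⟨.inl ⟨p, hp⟩, rfl⟩
      · exact ⟨.inr c, rfl⟩
    choose h hh using hp
    refine ⟨{v | (φ.relabel (Sum.elim (fun p => Equiv.sumAssoc C γ β (.inl (h p)))
      (fun b => .inr (.inr b)))).Realize (Sum.elim (fun x : C => (x : M)) v)},
      definable_iff_exists_formula_sum.2 ⟨_, rfl⟩, ?_⟩
    ext v
    simp only [mem_ofPred_eq, Language.Formula.realize_relabel]
    refine iff_of_eq (congrArg _ (funext ?_))
    rintro (p | b)
    · rw [Sum.elim_inl, ← hh p]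
      simp only [Function.comp_apply, Sum.elim_inl]
      cases h p <;> rfl
    · rfl
  · rintro ⟨T', hT', rfl⟩
    obtain ⟨φ, rfl⟩ := definable_iff_exists_formula_sum.1 hT'
    refine definable_iff_exists_formula_sum.2 ⟨φ.relabel (Sum.elim
      (fun c : C => .inl ⟨(c : M), .inl c.2⟩)
      (Sum.elim (fun g => .inl ⟨w g, .inr (mem_range_self g)⟩) .inr)), ?_⟩
    ext v
    simp only [mem_ofPred_eq, Language.Formula.realize_relabel]
    refine iff_of_eq (congrArg _ (funext ?_))
    rintro (c | g | b) <;> rfl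

lemma sameType_iff {C : Set M} {ι : Type*} {a a' : ι → M} :
    SameType L C a a' ↔ ∀ T : Set (ι → M), C.Definable L T → (a ∈ T ↔ a' ∈ T) :=
  ⟨by rintro h T ⟨φ, rfl⟩; exact h φ, fun h φ => h _ ⟨φ, rfl⟩⟩

/-- As definable sets are closed under complements, one implication suffices. -/
lemma sameType_of_imp {C : Set M} {ι : Type*} {a a' : ι → M}
    (h : ∀ T : Set (ι → M), C.Definable L T → a ∈ T → a' ∈ T) : SameType L C a a' :=
  sameType_iff.2 fun T hT =>
    ⟨h T hT, fun ha' => by_contra fun ha => h Tᶜ hT.compl ha ha'⟩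

lemma SameType.refl {C : Set M} {ι : Type*} (a : ι → M) : SameType L C a a := fun _ => Iff.rfl

lemma SameType.symm {C : Set M} {ι : Type*} {a a' : ι → M} (h : SameType L C a a') :
    SameType L C a' a := fun φ => (h φ).symm

lemma SameType.trans {C : Set M} {ι : Type*} {a b c : ι → M} (h : SameType L C a b)
    (h' : SameType L C b c) : SameType L C a c := fun φ => (h φ).trans (h' φ)

lemma SameType.mono {C D : Set M} (hCD : C ⊆ D) {ι : Type*} {a a' : ι → M}
    (h : SameType L D a a') : SameType L C a a' :=
  sameType_iff.2 fun T hT => sameType_iff.1 h T (hT.mono hCD)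

lemma SameType.comp {C : Set M} {ι ι' : Type*} {a a' : ι → M} (h : SameType L C a a')
    (f : ι' → ι) : SameType L C (a ∘ f) (a' ∘ f) :=
  sameType_iff.2 fun _ hT => sameType_iff.1 h _ (hT.preimage_comp f)

lemma sameType_union_range_iff {γ ι : Type*} {C : Set M} {w : γ → M} {a a' : ι → M} :
    SameType L (C ∪ range w) a a' ↔ SameType L C (Sum.elim w a) (Sum.elim w a') := by
  simp only [sameType_iff]
  constructor
  · intro h T hT
    exact h {v | Sum.elim w v ∈ T} (definable_union_range_iff.2 ⟨T, hT, rfl⟩)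
  · intro h T hT
    obtain ⟨T', hT', rfl⟩ := definable_union_range_iff.1 hT
    exact h T' hT'

lemma definable_setOf_realize {C : Set M} {ι : Type*} {n : ℕ} (φ : L.Formula (ι ⊕ Fin n))
    {b : Fin n → M} (hb : ∀ i, b i ∈ C) : C.Definable L {v : ι → M | φ.Realize (Sum.elim v b)} := by
  refine definable_iff_exists_formula_sum.2
    ⟨φ.relabel (Sum.elim .inr fun i => .inl ⟨b i, hb i⟩), ?_⟩
  ext v
  simp only [mem_ofPred_eq, Language.Formula.realize_relabel]
  refine iff_of_eq (congrArg _ (funext ?_))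
  rintro (c | g) <;> rfl

lemma SameType.realize_iff {C : Set M} {ι : Type*} {a a' : ι → M} (h : SameType L C a a')
    {n : ℕ} (φ : L.Formula (ι ⊕ Fin n)) {b : Fin n → M} (hb : ∀ i, b i ∈ C) :
    φ.Realize (Sum.elim a b) ↔ φ.Realize (Sum.elim a' b) :=
  sameType_iff.1 h _ (definable_setOf_realize φ hb)

end Definability

/-! ### Algebraic closure -/

section AlgebraicClosure

variable {L : FirstOrder.Language.{u, v}} {M : Type w} [L.Structure M]

open Set

lemma acl_mono {A B : Set M} (h : A ⊆ B) : acl L A ⊆ acl L B := by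
  rintro x ⟨S, hS, hfin, hx⟩
  exact ⟨S, Definable.mono hS h, hfin, hx⟩

lemma subset_acl (A : Set M) : A ⊆ acl L A := fun x hx =>
  ⟨{x}, Definable.singleton_of_mem L hx, finite_singleton x, rfl⟩

lemma exists_finset_of_mem_acl {A : Set M} {x : M} (hx : x ∈ acl L A) :
    ∃ A₀ : Finset M, (A₀ : Set M) ⊆ A ∧ x ∈ acl L (A₀ : Set M) := by
  obtain ⟨S, hS, hfin, hx⟩ := hx
  obtain ⟨A₀, hA₀, hd⟩ := definable_iff_finitely_definable.1 hS
  exact ⟨A₀, hA₀, S, hd, hfin, hx⟩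

/-- A set definable over `acl A` is a fibre of an `A`-definable set, at a point of a finite
`A`-definable set of tuples. -/
lemma exists_of_definable_acl {A : Set M} {α : Type*} {T : Set (α → M)}
    (hT : (acl L A).Definable L T) :
    ∃ (ι : Type w) (_ : Finite ι) (e : ι → M) (S : Set (ι → M)) (T' : Set (ι ⊕ α → M)),
      S.Finite ∧ e ∈ S ∧ A.Definable L S ∧ A.Definable L T' ∧
      T = {v | Sum.elim e v ∈ T'} := by
  obtain ⟨A₀, hA₀, hd⟩ := definable_iff_finitely_definable.1 hT
  have hA₀' : (A₀ : Set M) = ∅ ∪ range (fun x : A₀ => (x : M)) := by ext; simp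
  rw [hA₀', definable_union_range_iff] at hd
  obtain ⟨T', hT', rfl⟩ := hd
  choose S hS hfin hmem using fun x : A₀ => hA₀ x.2
  refine ⟨A₀, inferInstance, fun x => (x : M), Set.pi univ S, T', Finite.pi' hfin |>.subset
    (fun f hf i => hf i (mem_univ i)), fun x _ => hmem x, ?_, hT'.mono (empty_subset _), rfl⟩
  have : Set.pi univ S = ⋂ x : A₀, (fun v : A₀ → M => v ∘ fun _ : Fin 1 => x) ⁻¹'
      {y : Fin 1 → M | y 0 ∈ S x} := by
    ext; simp
  rw [this]
  exact definable_iInter_of_finite fun x => Definable.preimage_comp _ (hS x)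

/-- Algebraic closure is idempotent. Given a finite fibre with `k` elements of an `A`-definable
family over a finite `A`-definable set of tuples, the union of all fibres with at most `k` elements
is a finite `A`-definable set containing it. -/
lemma acl_acl (A : Set M) : acl L (acl L A) = acl L A := by
  refine (Subset.antisymm · (subset_acl _)) ?_
  rintro x ⟨X, hX, hXfin, hx⟩
  obtain ⟨ι, _, e, S, T, hSfin, he, hS, hT, hXT⟩ := exists_of_definable_acl hX
  have hXT' : ∀ y, y ∈ X ↔ Sum.elim e (fun _ : Fin 1 => y) ∈ T := fun y =>
    iff_of_eq (congrArg (fun Z : Set (Fin 1 → M) => (fun _ => y) ∈ Z) hXT)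
  set k := X.ncard
  -- the parameters whose fibre has more than `k` elements
  let G : Set (ι → M) := {e' | ∃ z : Fin (k + 1) → M,
    Function.Injective z ∧ ∀ i, Sum.elim e' (fun _ : Fin 1 => z i) ∈ T}
  have hG : A.Definable L G := by
    have h1 : A.Definable L {v : ι ⊕ Fin (k + 1) → M | ∀ i j, v (.inr i) = v (.inr j) → i = j} := by
      have : {v : ι ⊕ Fin (k + 1) → M | ∀ i j, v (.inr i) = v (.inr j) → i = j} =
          ⋂ i, ⋂ j, {v | v (.inr i) = v (.inr j) → i = j} := by
        ext; simp
      rw [this]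
      refine definable_iInter_of_finite fun i => definable_iInter_of_finite fun j => ?_
      by_cases hij : i = j
      · simp [hij]
      · have : {v : ι ⊕ Fin (k + 1) → M | v (.inr i) = v (.inr j) → i = j} =
            ((fun v : ι ⊕ Fin (k + 1) → M => v ∘ ![Sum.inr i, Sum.inr j]) ⁻¹'
              {x : Fin 2 → M | (x 0, x 1) ∈ diagonal M})ᶜ := by
          ext; simp [hij]
        rw [this]
        exact (Definable.preimage_comp _ (Definable.diagonal L A)).compl
    have h2 : A.Definable L {v : ι ⊕ Fin (k + 1) → M |
        ∀ i, Sum.elim (v ∘ .inl) (fun _ : Fin 1 => v (.inr i)) ∈ T} := by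
      have : {v : ι ⊕ Fin (k + 1) → M |
          ∀ i, Sum.elim (v ∘ .inl) (fun _ : Fin 1 => v (.inr i)) ∈ T} =
          ⋂ i, (fun v : ι ⊕ Fin (k + 1) → M => v ∘ Sum.elim .inl (fun _ : Fin 1 => .inr i)) ⁻¹'
            T := by
        ext v
        simp only [mem_ofPred_eq, mem_iInter, mem_preimage, Sum.comp_elim]
        rfl
      rw [this]
      exact definable_iInter_of_finite fun i => Definable.preimage_comp _ hT
    exact (h1.inter h2).exists_of_finite
  refine ⟨{y | ∃ e' : ι → M, e' ∈ S ∩ Gᶜ ∧ Sum.elim e' (fun _ : Fin 1 => y) ∈ T}, ?_, ?_,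
    ⟨e, ⟨he, ?_⟩, (hXT' x).1 hx⟩⟩
  · have h : A.Definable L {v : Fin 1 ⊕ ι → M | v ∘ .inr ∈ S ∩ Gᶜ ∧ 
        v ∘ (Sum.elim Sum.inr Sum.inl : ι ⊕ Fin 1 → Fin 1 ⊕ ι) ∈ T} :=
      ((hS.inter hG.compl).preimage_comp Sum.inr).inter
        (hT.preimage_comp (Sum.elim Sum.inr Sum.inl : ι ⊕ Fin 1 → Fin 1 ⊕ ι))
    rw [Definable₁]
    convert h.exists_of_finite using 1
    ext y
    refine exists_congr fun e' => and_congr Iff.rfl (iff_of_eq (congrArg (· ∈ T) (funext ?_)))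
    rintro (i | i)
    · rfl
    · exact congrArg y (Subsingleton.elim 0 i)
  · have : {y | ∃ e' : ι → M, e' ∈ S ∩ Gᶜ ∧ Sum.elim e' (fun _ : Fin 1 => y) ∈ T} =
        ⋃ e' ∈ S ∩ Gᶜ, {y | Sum.elim e' (fun _ : Fin 1 => y) ∈ T} := by
      ext; simp
    rw [this]
    refine (hSfin.inter_of_left _).biUnion fun e' he' => ?_
    by_contra hinf
    refine he'.2 ⟨fun i => Set.Infinite.natEmbedding _ hinf i, fun i j hij => ?_,
      fun i => (Set.Infinite.natEmbedding _ hinf i).2⟩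
    exact Fin.ext ((Set.Infinite.natEmbedding _ hinf).injective (Subtype.ext hij))
  · rintro ⟨z, hz, hzT⟩
    have h1 : (range z).ncard ≤ X.ncard :=
      ncard_le_ncard (by rintro _ ⟨i, rfl⟩; exact (hXT' _).2 (hzT i)) hXfin
    rw [← image_univ, ncard_image_of_injective _ hz, ncard_univ, Nat.card_fin] at h1
    exact absurd h1 (by simp [k])

lemma aclClosed_acl (A : Set M) : AclClosed L (acl L A) := acl_acl A

/-- In an infinite sequence all of whose increasing pairs have the same type over `A`, all members
have the same type over `acl A`. Indeed, a set definable over `acl A` is a union of classes of an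
`A`-definable equivalence relation with finitely many classes; two members of the sequence are
equivalent by the pigeonhole principle, hence any two are. -/
lemma sameType_acl_of_pairs {A : Set M} {J : Type*} [LinearOrder J] [Infinite J] {α : Type*}
    {y : J → α → M}
    (h : ∀ i j i' j', i < j → i' < j' →
      SameType L A (Sum.elim (y i) (y j)) (Sum.elim (y i') (y j'))) (i j : J) :
    SameType L (acl L A) (y i) (y j) := by
  refine sameType_iff.2 fun T hT => ?_
  obtain ⟨ι, _, e, S, T', hSfin, he, hS, hT', rfl⟩ := exists_of_definable_acl hT
  -- the equivalence relation: membership in the same fibres over `S`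
  let Q : Set (α ⊕ α → M) := {v | ∀ e' : ι → M,
    e' ∈ S → (Sum.elim e' (v ∘ .inl) ∈ T' ↔ Sum.elim e' (v ∘ .inr) ∈ T')}
  have hQ : A.Definable L Q := by
    let V : Set ((α ⊕ α) ⊕ ι → M) := (fun v => v ∘ .inr) ⁻¹' S
    let V₁ : Set ((α ⊕ α) ⊕ ι → M) :=
      (fun v => v ∘ Sum.elim .inr (fun a => .inl (.inl a))) ⁻¹' T'
    let V₂ : Set ((α ⊕ α) ⊕ ι → M) :=
      (fun v => v ∘ Sum.elim .inr (fun a => .inl (.inr a))) ⁻¹' T'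
    have hV : A.Definable L V := hS.preimage_comp _
    have hV₁ : A.Definable L V₁ := hT'.preimage_comp _
    have hV₂ : A.Definable L V₂ := hT'.preimage_comp _
    convert (hV.compl.union
      ((hV₁.inter hV₂).union (hV₁.compl.inter hV₂.compl))).forall_of_finite using 1
    ext v
    refine forall_congr' fun e' => ?_
    have e1 : Sum.elim v e' ∈ V ↔ e' ∈ S := Iff.rfl
    have e2 : Sum.elim v e' ∈ V₁ ↔ Sum.elim e' (v ∘ .inl) ∈ T' := by
      simp only [V₁, mem_preimage, Sum.comp_elim]; rfl
    have e3 : Sum.elim v e' ∈ V₂ ↔ Sum.elim e' (v ∘ .inr) ∈ T' := by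
      simp only [V₂, mem_preimage, Sum.comp_elim]; rfl
    simp only [mem_union, mem_inter_iff, mem_compl_iff, e1, e2, e3]
    tauto
  have key : ∀ i j, i < j → Sum.elim (y i) (y j) ∈ Q := by
    have := hSfin.to_subtype
    obtain ⟨i₀, j₀, hne, heq⟩ := Finite.exists_ne_map_eq_of_infinite
      (fun i : J => {e' : S | Sum.elim (e' : ι → M) (y i) ∈ T'})
    have hiff : ∀ e' ∈ S, Sum.elim e' (y i₀) ∈ T' ↔ Sum.elim e' (y j₀) ∈ T' :=
      fun e' he' => Set.ext_iff.1 heq ⟨e', he'⟩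
    intro i j hij
    rcases lt_or_gt_of_ne hne with h0 | h0
    · exact (sameType_iff.1 (h i₀ j₀ i j h0 hij) Q hQ).1 hiff
    · exact (sameType_iff.1 (h j₀ i₀ i j h0 hij) Q hQ).1 fun e' he' => (hiff e' he').symm
  rcases lt_trichotomy i j with hij | rfl | hij
  · exact key i j hij e he
  · rfl
  · exact (key j i hij e he).symm

lemma mk_acl_lt {κ : Cardinal.{w}} (hM : IsMonster L M κ) {A : Set M} (hA : #A < κ) :
    #(acl L A) < κ := by
  have hφ : ∀ x : acl L A, ∃ φ : L[[A]].Formula (Fin 1),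
      {y : M | φ.Realize fun _ => y}.Finite ∧ φ.Realize fun _ => (x : M) := by
    rintro ⟨x, S, ⟨φ, hφ⟩, hfin, hx⟩
    have : ∀ y, y ∈ S ↔ φ.Realize fun _ => y := fun y =>
      iff_of_eq (congrArg (fun Z : Set (Fin 1 → M) => (fun _ => y) ∈ Z) hφ)
    refine ⟨φ, hfin.subset fun y hy => (this y).2 hy, (this x).1 hx⟩
  choose φ hfin hreal using hφ
  have hc : ∀ φ : L[[A]].Formula (Fin 1), ∃ f : M → ℕ,
      {y : M | φ.Realize fun _ => y}.Finite → InjOn f {y : M | φ.Realize fun _ => y} := by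
    intro φ
    by_cases h : {y : M | φ.Realize fun _ => y}.Finite
    · obtain ⟨f, hf⟩ := countable_iff_exists_injOn.1 h.countable
      exact ⟨f, fun _ => hf⟩
    · exact ⟨fun _ => 0, fun h' => absurd h' h⟩
  choose f hf using hc
  have hinj : Function.Injective
      (fun x : acl L A => ((φ x, f (φ x) x) : L[[A]].Formula (Fin 1) × ℕ)) := by
    intro x y hxy
    simp only [Prod.mk.injEq] at hxy
    refine Subtype.ext (hf (φ x) (hfin x) (hreal x) ?_ ?_)
    · rw [hxy.1]; exact hreal y
    · rw [hxy.2, hxy.1]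
  have h1 := Cardinal.lift_mk_le_lift_mk_of_injective hinj
  have hκ : ℵ₀ < Cardinal.lift.{max u v} κ := by simpa using hM.aleph0_lt
  have h2 : #(L[[A]].Formula (Fin 1)) < Cardinal.lift.{max u v} κ := by
    refine lt_of_le_of_lt ((Cardinal.mk_le_of_injective (f := fun φ => (⟨0, φ⟩ :
      Σ n, L[[A]].BoundedFormula (Fin 1) n)) fun a b h => by simpa using h).trans
      (Language.BoundedFormula.card_le (L := L[[A]]) (α := Fin 1))) (max_lt hκ ?_)
    rw [Language.card_withConstants]
    refine Cardinal.add_lt_of_lt hκ.le ?_ ?_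
    · simpa using (Cardinal.natCast_lt_aleph0 (n := 1)).trans hκ
    · have h := Cardinal.add_lt_of_lt hκ.le hM.card_lt (Cardinal.lift_lt.{w, max u v}.2 hA)
      simpa using h
  have h3 : #(L[[A]].Formula (Fin 1) × ℕ) < Cardinal.lift.{max u v} κ := by
    simpa using Cardinal.mul_lt_of_lt hκ.le h2 (by simpa using hM.aleph0_lt)
  have h4 := h1.trans_lt (Cardinal.lift_lt.2 h3)
  rw [Cardinal.lift_lift] at h4
  exact Cardinal.lift_lt.1 h4

end AlgebraicClosure

/-! ### Saturation and homogeneity -/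

section Monster

variable {L : FirstOrder.Language.{u, v}} {M : Type w} [L.Structure M]

open Set

/-- Saturation in terms of definable sets. -/
lemma IsMonster.exists_forall_mem {κ : Cardinal.{w}} (hM : IsMonster L M κ) {C : Set M}
    (hC : #C < κ) {ι : Type w} (hι : #ι < κ) {J : Type*} {T : J → Set (ι → M)}
    (hT : ∀ j, C.Definable L (T j)) (hfin : ∀ F : Finset J, ∃ a, ∀ j ∈ F, a ∈ T j) :
    ∃ a, ∀ j, a ∈ T j := by
  classical
  choose φ hφ using hT
  obtain ⟨a, ha⟩ := hM.saturated C ι hC hι (range φ) fun p₀ hp₀ => by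
    rw [← image_univ] at hp₀
    obtain ⟨F, -, rfl⟩ := Finset.subset_set_image_iff.1 hp₀
    obtain ⟨a, ha⟩ := hfin F
    refine ⟨a, fun ψ hψ => ?_⟩
    obtain ⟨j, hj, rfl⟩ := Finset.mem_image.1 hψ
    have := ha j hj
    rw [hφ j] at this
    exact this
  exact ⟨a, fun j => by rw [hφ j]; exact ha _ (mem_range_self j)⟩

lemma sameType_empty_automorphism (σ : M ≃[L] M) {ι : Type*} (a : ι → M) :
    SameType L (∅ : Set M) a (σ ∘ a) := by
  refine sameType_iff.2 fun T hT => ?_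
  obtain ⟨φ, rfl⟩ := empty_definable_iff.1 hT
  exact (Language.StrongHomClass.realize_formula σ φ).symm

/-- Strong homogeneity for tuples: tuples with the same type are conjugate. -/
lemma IsMonster.exists_automorphism {κ : Cardinal.{w}} (hM : IsMonster L M κ) {ι : Type*}
    {a a' : ι → M} (ha : #(range a) < κ) (h : SameType L (∅ : Set M) a a') :
    ∃ σ : M ≃[L] M, ∀ i, σ (a i) = a' i := by
  choose r hr using fun x : range a => x.2
  obtain ⟨σ, hσ⟩ := hM.stronglyHomogeneous (range a) (a' ∘ r) ha (by
    have := h.comp r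
    rwa [show a ∘ r = fun x : range a => (x : M) from funext hr] at this)
  refine ⟨σ, fun i => (hσ ⟨a i, mem_range_self i⟩).trans ?_⟩
  -- equality of two coordinates is part of the type
  have hD : (∅ : Set M).Definable L {v : ι → M | v (r ⟨a i, mem_range_self i⟩) = v i} :=
    (Definable.diagonal L ∅).preimage_comp ![r ⟨a i, mem_range_self i⟩, i]
  exact (sameType_iff.1 h _ hD).1 (hr ⟨a i, mem_range_self i⟩)

lemma IsMonster.exists_automorphism_fixing {κ : Cardinal.{w}} (hM : IsMonster L M κ) {E : Set M}
    (hE : #E < κ) {n : ℕ} {a a' : Fin n → M} (h : SameType L E a a') :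
    ∃ σ : M ≃[L] M, (∀ x ∈ E, σ x = x) ∧ ∀ i, σ (a i) = a' i := by
  have hE' : E = ∅ ∪ range (fun x : E => (x : M)) := by simp
  rw [hE', sameType_union_range_iff] at h
  obtain ⟨σ, hσ⟩ := hM.exists_automorphism (by
    rw [Sum.elim_range, Subtype.range_coe]
    exact (mk_union_le _ _).trans_lt (Cardinal.add_lt_of_lt hM.aleph0_lt.le hE
      ((Set.finite_range a).lt_aleph0.trans hM.aleph0_lt))) h
  exact ⟨σ, fun x hx => hσ (.inl ⟨x, hx⟩), fun i => hσ (.inr i)⟩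

lemma sameType_automorphism_fixing {E : Set M} (σ : M ≃[L] M) (hσ : ∀ x ∈ E, σ x = x)
    {ι : Type*} (a : ι → M) : SameType L E (σ ∘ a) a := by
  have h := sameType_empty_automorphism σ (Sum.elim (fun x : E => (x : M)) a)
  rw [Sum.comp_elim, show (σ ∘ fun x : E => (x : M)) = fun x : E => (x : M) from
    funext fun x => hσ x x.2, ← sameType_union_range_iff, Subtype.range_coe, empty_union] at h
  exact h.symm

end Monster

/-! ### Indiscernible sequences -/

section Indiscernible

variable {L : FirstOrder.Language.{u, v}} {M : Type w} [L.Structure M]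

open Set

/-- Indiscernibility over `C` of a family of `n`-tuples indexed by a linear order. -/
def IndiscernibleOn (L : FirstOrder.Language.{u, v}) {M : Type w} [L.Structure M] (C : Set M)
    {I : Type*} [LinearOrder I] {n : ℕ} (s : I → Fin n → M) : Prop :=
  ∀ (k : ℕ) (f g : Fin k ↪o I),
    SameType L C (fun p : Fin k × Fin n => s (f p.1) p.2)
      (fun p : Fin k × Fin n => s (g p.1) p.2)

lemma Indiscernible.mono {C D : Set M} (hCD : C ⊆ D) {n : ℕ} {s : ℕ → Fin n → M}
    (h : Indiscernible L D s) : Indiscernible L C s := fun k f g => (h k f g).mono hCD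

/-- Families of indices with the same order pattern, possibly with repetitions, give tuples of
the same type. -/
lemma IndiscernibleOn.sameType {C : Set M} {I : Type*} [LinearOrder I] {n : ℕ}
    {s : I → Fin n → M} (hs : IndiscernibleOn L C s) {ι : Type*} [Finite ι] {f g : ι → I}
    (hfg : ∀ a b, f a < f b ↔ g a < g b) :
    SameType L C (fun p : ι × Fin n => s (f p.1) p.2) (fun p : ι × Fin n => s (g p.1) p.2) := by
  classical
  have := Fintype.ofFinite ι
  let A : Finset I := Finset.univ.image f
  let F : Fin A.card ↪o I := A.orderEmbOfFin rfl
  have hr : ∀ i, ∃ a, f a = F i := fun i => by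
    have h : F i ∈ A := A.orderEmbOfFin_mem rfl i
    simpa [A] using h
  choose r hr using hr
  have hidx : ∀ a, ∃ i, F i = f a := fun a => by
    have : f a ∈ range F := by
      rw [Finset.range_orderEmbOfFin]
      simp [A]
    exact this
  choose idx hidx using hidx
  let G : Fin A.card ↪o I := OrderEmbedding.ofStrictMono (g ∘ r) fun i j hij => by
    rw [Function.comp_apply, Function.comp_apply, ← hfg, hr, hr]
    exact F.lt_iff_lt.2 hij
  have hG : ∀ a, G (idx a) = g a := by
    intro a
    have e : f (r (idx a)) = f a := by rw [hr, hidx]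
    have h1 : ¬ g (r (idx a)) < g a := by rw [← hfg, e]; exact lt_irrefl _
    have h2 : ¬ g a < g (r (idx a)) := by rw [← hfg, e]; exact lt_irrefl _
    exact le_antisymm (not_lt.1 h2) (not_lt.1 h1)
  have h := (hs A.card F G).comp (Prod.map idx (id : Fin n → Fin n))
  convert h using 1
  · funext p; simp [hidx]
  · funext p; simp [hG]

/-- Let `F` be a finite set of indices and `J` an infinite set of indices lying in one cut of
`F`. Then the members with index in `J` have the same type over the algebraic closure of `C` and the
members with index in `F`. -/
lemma IndiscernibleOn.sameType_acl {C : Set M} {I : Type*} [LinearOrder I] {n : ℕ}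
    {s : I → Fin n → M} (hs : IndiscernibleOn L C s) (F : Finset I) {J : Set I} (hJ : J.Infinite)
    (hFJ : ∀ i ∈ F, (∀ j ∈ J, i < j) ∨ (∀ j ∈ J, j < i)) {j j' : I} (hj : j ∈ J) (hj' : j' ∈ J) :
    SameType L (acl L (C ∪ range fun p : F × Fin n => s p.1 p.2)) (s j) (s j') := by
  have := hJ.to_subtype
  refine sameType_acl_of_pairs (y := fun j : J => s j) ?_ ⟨j, hj⟩ ⟨j', hj'⟩
  intro i₁ i₂ i₁' i₂' h h'
  rw [sameType_union_range_iff]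
  have hcut : ∀ (a : F) (b b' : J), ((a : I) < b ↔ (a : I) < b') ∧ ((b : I) < a ↔ (b' : I) < a) := by
    intro a b b'
    rcases hFJ a a.2 with h0 | h0 <;>
      simp [h0 _ b.2, h0 _ b'.2, (h0 _ b.2).not_gt, (h0 _ b'.2).not_gt]
  have key := hs.sameType (ι := F ⊕ Bool)
    (f := Sum.elim (fun x => (x : I)) fun b => bif b then i₂ else i₁)
    (g := Sum.elim (fun x => (x : I)) fun b => bif b then i₂' else i₁') (by
      rintro (a | a | a) (b | b | b) <;>
        simp only [Sum.elim_inl, Sum.elim_inr, cond_true, cond_false, lt_irrefl, Subtype.coe_lt_coe,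
          h, h', h.not_gt, h'.not_gt]
      exacts [(hcut a _ _).1, (hcut a _ _).1, (hcut b _ _).2, (hcut b _ _).2])
  have h2 := key.comp (Sum.elim (fun p : F × Fin n => (Sum.inl p.1, p.2))
    (Sum.elim (fun t : Fin n => (Sum.inr false, t)) fun t : Fin n => (Sum.inr true, t)))
  convert h2 using 1 <;>
  · funext x
    rcases x with p | t | t <;> rfl

/-- A set definable over the algebraic closure of `C` and a union of tuples is definable over the
algebraic closure of `C` and finitely many of these tuples. -/
lemma exists_finset_definable_acl {C : Set M} {I : Type*} {n : ℕ} {s : I → Fin n → M} {G : Set I}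
    {α : Type*} {T : Set (α → M)}
    (hT : (acl L (C ∪ range fun p : G × Fin n => s p.1 p.2)).Definable L T) :
    ∃ F : Finset I, (F : Set I) ⊆ G ∧
      (acl L (C ∪ range fun p : F × Fin n => s p.1 p.2)).Definable L T := by
  classical
  have h1 : ∀ x ∈ C ∪ range (fun p : G × Fin n => s p.1 p.2), ∃ F : Finset I, (F : Set I) ⊆ G ∧
      x ∈ C ∪ range fun p : F × Fin n => s p.1 p.2 := by
    rintro x (hx | ⟨⟨i, t⟩, rfl⟩)
    · exact ⟨∅, by simp, .inl hx⟩
    · exact ⟨{i.1}, by simp, .inr ⟨(⟨i.1, by simp⟩, t), rfl⟩⟩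
  have hmono : ∀ F F' : Finset I, F ⊆ F' → C ∪ range (fun p : F × Fin n => s p.1 p.2) ⊆
      C ∪ range (fun p : F' × Fin n => s p.1 p.2) := by
    rintro F F' h x (hx | ⟨⟨i, t⟩, rfl⟩)
    · exact .inl hx
    · exact .inr ⟨(⟨i.1, h i.2⟩, t), rfl⟩
  have h2 : ∀ X : Finset M, (X : Set M) ⊆ C ∪ range (fun p : G × Fin n => s p.1 p.2) →
      ∃ F : Finset I, (F : Set I) ⊆ G ∧ (X : Set M) ⊆ C ∪ range fun p : F × Fin n => s p.1 p.2 := by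
    intro X hX
    choose! F hF hF' using h1
    refine ⟨X.biUnion F, by simpa using fun x hx => hF x (hX hx), fun x hx => ?_⟩
    exact hmono _ _ (Finset.subset_biUnion_of_mem F hx) (hF' x (hX hx))
  have h3 : ∀ x ∈ acl L (C ∪ range (fun p : G × Fin n => s p.1 p.2)), ∃ F : Finset I,
      (F : Set I) ⊆ G ∧ x ∈ acl L (C ∪ range fun p : F × Fin n => s p.1 p.2) := by
    intro x hx
    obtain ⟨X, hX, hxX⟩ := exists_finset_of_mem_acl hx
    obtain ⟨F, hF, hXF⟩ := h2 X hX
    exact ⟨F, hF, acl_mono hXF hxX⟩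
  obtain ⟨X, hX, hd⟩ := definable_iff_finitely_definable.1 hT
  choose! F hF hF' using h3
  refine ⟨X.biUnion F, by simpa using fun x hx => hF x (hX hx), hd.mono fun x hx => ?_⟩
  exact acl_mono (hmono _ _ (Finset.subset_biUnion_of_mem F hx)) (hF' x (hX hx))

/-- An indiscernible sequence `(s_i)` can be prolonged by a sequence in reversed order, to an
indiscernible family of order type `ω + ω*`. -/
lemma IsMonster.exists_indiscernibleOn {κ : Cardinal.{w}} (hM : IsMonster L M κ) {C : Set M}
    (hC : #C < κ) {n : ℕ} {s : ℕ → Fin n → M} (hs : Indiscernible L C s) :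
    ∃ x : ℕ → Fin n → M, IndiscernibleOn L C
      (fun i : ℕ ⊕ₗ ℕᵒᵈ => Sum.elim s (x ∘ OrderDual.ofDual) (ofLex i)) := by
  classical
  let P : Set M := C ∪ range fun p : ℕ × Fin n => s p.1 p.2
  have hP : #P < κ := (mk_union_le _ _).trans_lt (Cardinal.add_lt_of_lt hM.aleph0_lt.le hC
    ((Set.countable_range _).le_aleph0.trans_lt hM.aleph0_lt))
  -- the conditions that hold of `(s_{g 0}, s_{g 1}, …)` whenever `g` decreases on a sufficiently
  -- long initial segment and takes sufficiently large values there
  let J : Type w := {Θ : Set (ULift.{w} (ℕ × Fin n) → M) // P.Definable L Θ ∧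
    ∃ N, ∀ g : ℕ → ℕ, (∀ i < N, N ≤ g i) → (∀ i j, i < j → j < N → g j < g i) →
      (fun p => s (g p.down.1) p.down.2) ∈ Θ}
  obtain ⟨X, hX⟩ := hM.exists_forall_mem hP (ι := ULift.{w} (ℕ × Fin n))
    (Cardinal.mk_le_aleph0.trans_lt hM.aleph0_lt) (T := fun j : J => j.1) (fun j => j.2.1) (fun F => by
      choose N hN using fun j : J => j.2.2
      refine ⟨fun p => s (2 * F.sup N - p.down.1) p.down.2, fun j hj =>
        hN j (fun i => 2 * F.sup N - i) ?_ ?_⟩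
      all_goals have := Finset.le_sup (f := N) hj
      · intro i hi; omega
      · intro i i' hi hi'; omega)
  refine ⟨fun i t => X ⟨i, t⟩, ?_⟩
  suffices key : ∀ (k : ℕ) (f : Fin k ↪o ℕ ⊕ₗ ℕᵒᵈ), SameType L C
      (fun p : Fin k × Fin n => s p.1 p.2)
      (fun p : Fin k × Fin n => Sum.elim s
        ((fun i t => X ⟨i, t⟩) ∘ OrderDual.ofDual) (ofLex (f p.1)) p.2) from
    fun k f g => (key k f).symm.trans (key k g)
  intro k f
  refine sameType_of_imp fun T hT hsT => ?_
  let h : Fin k × Fin n → (ℕ × Fin n) ⊕ ULift.{w} (ℕ × Fin n) := fun p =>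
    Sum.elim (fun i => .inl (i, p.2)) (fun i => .inr ⟨OrderDual.ofDual i, p.2⟩) (ofLex (f p.1))
  let q : Fin k → ℕ := fun a =>
    Sum.elim (fun i => i + 1) (fun i => OrderDual.ofDual i + 1) (ofLex (f a))
  have hmem := hX ⟨{Y | (Sum.elim (fun p : ℕ × Fin n => s p.1 p.2) Y) ∘ h ∈ T},
    definable_union_range_iff.2 ⟨_, hT.preimage_comp h, rfl⟩, Finset.univ.sup q,
    fun g hg₁ hg₂ => ?_⟩
  · refine (iff_of_eq (congrArg (· ∈ T) (funext fun p => ?_))).1 hmem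
    simp only [Function.comp_apply, h]
    rcases ofLex (f p.1) with i | i <;> rfl
  · have hq : ∀ a, q a ≤ Finset.univ.sup q := fun a => Finset.le_sup (Finset.mem_univ a)
    generalize Finset.univ.sup q = N at hg₁ hg₂ hq
    let f₀ : Fin k → ℕ := fun a => Sum.elim id (fun i => g (OrderDual.ofDual i)) (ofLex (f a))
    have hf₀ : StrictMono f₀ := by
      intro a b hab
      have hab' : f a < f b := f.lt_iff_lt.2 hab
      have ha := hq a
      have hb := hq b
      rw [Sum.Lex.lt_def] at hab'
      revert hab' ha hb
      dsimp only [q, f₀]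
      rcases ofLex (f a) with i | i <;> rcases ofLex (f b) with j | j <;>
        simp only [Sum.elim_inl, Sum.elim_inr, Sum.lex_inl_inl, Sum.lex_inr_inr,
          Sum.lex_inr_inl, Sum.Lex.sep, id, false_imp_iff]
      · exact fun h _ _ => h
      · intro _ h1 h2
        exact lt_of_lt_of_le (Nat.lt_of_succ_le h1) (hg₁ _ (Nat.lt_of_succ_le h2))
      · intro h h1 _
        exact hg₂ _ _ h (Nat.lt_of_succ_le h1)
    have := (sameType_iff.1 (hs k (Fin.valOrderEmb k) (OrderEmbedding.ofStrictMono f₀ hf₀)) T hT).1 hsT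
    refine (iff_of_eq (congrArg (· ∈ T) (funext fun p => ?_))).1 this
    simp only [Function.comp_apply, h, f₀, OrderEmbedding.coe_ofStrictMono]
    rcases ofLex (f p.1) with i | i <;> rfl

end Indiscernible

/-! ### Coheirs from indiscernible sequences -/

section Coheir

variable {L : FirstOrder.Language.{u, v}} {M : Type w} [L.Structure M]

open Set

/-- For an indiscernible family `s ⌢ x` of order type `ω + ω*`, the members of `s` have the same
type over the algebraic closure of `x`. -/
lemma IndiscernibleOn.sameType_acl_range {C : Set M} {n : ℕ} {s x : ℕ → Fin n → M}
    (h : IndiscernibleOn L C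
      (fun i : ℕ ⊕ₗ ℕᵒᵈ => Sum.elim s (x ∘ OrderDual.ofDual) (ofLex i))) (i j : ℕ) :
    SameType L (acl L (C ∪ range fun p : ℕ × Fin n => x p.1 p.2)) (s i) (s j) := by
  set S := fun i : ℕ ⊕ₗ ℕᵒᵈ => Sum.elim s (x ∘ OrderDual.ofDual) (ofLex i)
  refine sameType_iff.2 fun T hT => ?_
  let G : Set (ℕ ⊕ₗ ℕᵒᵈ) := range fun i => toLex (Sum.inr i)
  obtain ⟨F, hF, hd⟩ := exists_finset_definable_acl (s := S) (G := G) (hT.mono (acl_mono (by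
    rintro y (hy | ⟨⟨k, t⟩, rfl⟩)
    · exact .inl hy
    · exact .inr ⟨(⟨toLex (.inr (OrderDual.toDual k)), mem_range_self _⟩, t), rfl⟩)))
  have hinj : Function.Injective fun i : ℕ => (toLex (Sum.inl i) : ℕ ⊕ₗ ℕᵒᵈ) :=
    toLex.injective.comp Sum.inl_injective
  refine sameType_iff.1 (h.sameType_acl F (infinite_range_of_injective hinj) ?_
    (mem_range_self i) (mem_range_self j)) T hd
  intro k hk
  obtain ⟨k, rfl⟩ := hF hk
  right
  rintro _ ⟨l, rfl⟩
  exact Sum.Lex.inl_lt_inr _ _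

/-- For an indiscernible family `s ⌢ x` of order type `ω + ω*`, the type of `s_{m+1}` over
`s_0, …, s_m` and the algebraic closure of `x` is finitely satisfiable in the latter: a formula of
this type involves only finitely many members of `x`, so the members of larger index realise it. -/
lemma IndiscernibleOn.coheirIndep {C : Set M} {n : ℕ} {s x : ℕ → Fin n → M}
    (h : IndiscernibleOn L C
      (fun i : ℕ ⊕ₗ ℕᵒᵈ => Sum.elim s (x ∘ OrderDual.ofDual) (ofLex i))) (m : ℕ) :
    coheirIndep L (range (s (m + 1))) (acl L (C ∪ range fun p : ℕ × Fin n => x p.1 p.2))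
      {y | ∃ i ≤ m, ∃ t, s i t = y} := by
  set S := fun i : ℕ ⊕ₗ ℕᵒᵈ => Sum.elim s (x ∘ OrderDual.ofDual) (ofLex i)
  intro N a ha φ hφ
  choose r hr using ha
  obtain rfl : s (m + 1) ∘ r = a := funext hr
  let G : Set (ℕ ⊕ₗ ℕᵒᵈ) :=
    (range fun i => toLex (Sum.inr i)) ∪ (fun i => toLex (Sum.inl i)) '' Iic m
  have hT : (acl L (C ∪ range fun p : G × Fin n => S p.1 p.2)).Definable L
      {v : Fin n → M | φ.Realize (v ∘ r)} := by
    have hd := Definable.preimage_comp (A := _) (L := L) r ⟨φ, rfl⟩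
    refine hd.mono ?_
    rintro y (hy | ⟨i, hi, t, rfl⟩)
    · refine acl_mono ?_ hy
      rintro y (hy | ⟨⟨k, t⟩, rfl⟩)
      · exact .inl hy
      · exact .inr ⟨(⟨toLex (.inr (OrderDual.toDual k)), .inl (mem_range_self _)⟩, t), rfl⟩
    · exact subset_acl _ (.inr ⟨(⟨toLex (.inl i), .inr (mem_image_of_mem _ hi)⟩, t), rfl⟩)
  obtain ⟨F, hF, hd⟩ := exists_finset_definable_acl hT
  obtain ⟨K, hK⟩ : ∃ K : ℕ, ∀ j : ℕ,
      (toLex (Sum.inr (OrderDual.toDual j)) : ℕ ⊕ₗ ℕᵒᵈ) ∈ F → j < K := by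
    have hfin : {j : ℕ | (toLex (Sum.inr (OrderDual.toDual j)) : ℕ ⊕ₗ ℕᵒᵈ) ∈ F}.Finite :=
      F.finite_toSet.preimage
        ((toLex.injective.comp Sum.inr_injective).comp OrderDual.toDual.injective).injOn
    obtain ⟨K, hK⟩ := hfin.bddAbove
    exact ⟨K + 1, fun j hj => Nat.lt_succ_of_le (hK hj)⟩
  let J : Set (ℕ ⊕ₗ ℕᵒᵈ) := insert (toLex (Sum.inl (m + 1)))
    (range fun j : ℕ => toLex (Sum.inr (OrderDual.toDual (K + j))))
  have hJ : J.Infinite := by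
    refine (infinite_range_of_injective ?_).mono (subset_insert _ _)
    intro i j hij
    have := OrderDual.toDual.injective (Sum.inr_injective (toLex.injective hij))
    omega
  have hsame := h.sameType_acl F hJ (j := toLex (Sum.inl (m + 1)))
    (j' := toLex (Sum.inr (OrderDual.toDual (K + 0)))) ?_ (mem_insert _ _)
    (mem_insert_of_mem _ (mem_range_self 0))
  · refine ⟨x (K + 0) ∘ r, fun i => subset_acl _ (.inr ⟨(K + 0, r i), rfl⟩), ?_⟩
    exact (sameType_iff.1 hsame _ hd).1 hφ
  · intro k hk
    obtain ⟨k, rfl⟩ | ⟨k, hkm, rfl⟩ := hF hk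
    · right
      rintro _ (rfl | ⟨l, rfl⟩)
      · exact Sum.Lex.inl_lt_inr _ _
      · refine Sum.Lex.inr_lt_inr_iff.2 (OrderDual.toDual_lt.2 ?_)
        exact (hK _ hk).trans_le (Nat.le_add_right _ _)
    · left
      rintro _ (rfl | ⟨l, rfl⟩)
      · exact Sum.Lex.inl_lt_inl_iff.2 (Nat.lt_succ_of_le hkm)
      · exact Sum.Lex.inl_lt_inr _ _

end Coheir

/-! ### Comparison of the independence relations -/

section Comparison

variable {L : FirstOrder.Language.{u, v}} {M : Type w} [L.Structure M]

open Set

/-- A formula dividing over `D` divides over every smaller set, so `⫝^d` is base monotone. As it is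
stronger than `R`, it is stronger than the monotonisation of `R`. -/
lemma monotonised_of_dividingIndep {κ : Cardinal.{w}} (hM : IsMonster L M κ) {R : TernaryRel M}
    (hweak : ∀ A C B : Set M, #A < κ → #C < κ → #B < κ → dividingIndep L A C B → R A C B)
    {A C B : Set M} (hA : #A < κ) (hC : #C < κ) (hB : #B < κ) (h : dividingIndep L A C B) :
    monotonised R A C B := by
  have hun : ∀ {X Y : Set M}, #X < κ → #Y < κ → #(X ∪ Y : Set M) < κ := fun hX hY =>
    (mk_union_le _ _).trans_lt (Cardinal.add_lt_of_lt hM.aleph0_lt.le hX hY)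
  intro D hD
  refine hweak _ _ _ hA (hun hC ((mk_le_mk_of_subset hD).trans_lt (hun hC hB))) (hun hB hC) ?_
  intro n φ b hb hφ hdiv
  refine h n φ b (fun i => ?_) hφ ?_
  · rcases hb i with (h | h) | h | h
    exacts [.inl h, hD h, .inr h, .inl h]
  · obtain ⟨s, h0, hs, hno⟩ := hdiv
    exact ⟨s, h0, hs.mono subset_union_left, hno⟩

lemma dividingIndep_of_forkingIndep {A C B : Set M} (h : forkingIndep L A C B) :
    dividingIndep L A C B := fun n φ b hb hφ hdiv =>
  h n φ b hb hφ ⟨1, fun _ => n, fun _ => φ, fun _ => b, fun _ => hdiv, fun _ ha => ⟨0, ha⟩⟩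

lemma Invariance.automorphism {κ : Cardinal.{w}} {R : TernaryRel M} (hinv : Invariance L κ R)
    (σ : M ≃[L] M) {A C B : Set M} (hA : #A < κ) (hC : #C < κ) (hB : #B < κ) (h : R A C B) :
    R (σ '' A) (σ '' C) (σ '' B) := by
  have key := hinv A B C hA hB hC (fun x => x) (σ ∘ fun x => x) (fun x => x) (σ ∘ fun x => x)
    (fun x => x) (σ ∘ fun x => x) (by
      have := sameType_empty_automorphism σ
        (Sum.elim (fun x : A => (x : M)) (Sum.elim (fun x : B => (x : M)) fun x : C => (x : M)))
      rwa [Sum.comp_elim, Sum.comp_elim] at this)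
  simp only [range_comp, Subtype.range_coe] at key
  exact key.1 h

/-- Suppose that `φ(x, b)` in `tp(A / CB)` divides over `C`, as witnessed by a `C`-indiscernible
sequence `s`. Prolong `s` by a sequence `x` of order type `ω*` and let `E = acl(C x)`. By extension,
`A` may be assumed to be independent from `E` and `s_0` over `C` in the sense of `⫝^m`; by the
definition of `⫝^m` it is then `R`-independent from `s_0` over `E`. Conjugates of `A` over
`E` are `R`-independent from each of the `s_i`; as `s_{m+1} ⫝^u_E s_0 … s_m`, they can be amalgamated
one after the other, so that the formulas `φ(x, s_i)` are consistent. -/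
lemma dividingIndep_of_monotonised {κ : Cardinal.{w}} (hM : IsMonster L M κ) {R : TernaryRel M}
    (hinv : Invariance L κ R) (hmon : Monotonicity κ R)
    (ham : ∀ E : Set M, #E < κ → AclClosed L E → AmalgamationOver L κ (coheirIndep L) R E)
    {A C B : Set M} (hA : #A < κ) (hC : #C < κ) (hB : #B < κ)
    (hext : ExtensionOver L κ (monotonised R) C) (h : monotonised R A C B) :
    dividingIndep L A C B := by
  have hun : ∀ {X Y : Set M}, #X < κ → #Y < κ → #(X ∪ Y : Set M) < κ := fun hX hY =>
    (mk_union_le _ _).trans_lt (Cardinal.add_lt_of_lt hM.aleph0_lt.le hX hY)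
  have hcount : ∀ {X : Set M}, X.Countable → #X < κ := fun hX =>
    hX.le_aleph0.trans_lt hM.aleph0_lt
  rintro n φ b hb hφ ⟨s, rfl, hs, hno⟩
  obtain ⟨x, hx⟩ := hM.exists_indiscernibleOn hC hs
  set E := acl L (C ∪ range fun p : ℕ × Fin n => x p.1 p.2)
  have hE : #E < κ := mk_acl_lt hM (hun hC (hcount (countable_range _)))
  have hCE : C ⊆ E := subset_union_left.trans (subset_acl _)
  obtain ⟨a, ha, haR⟩ := hext A B E hA hB hE h
  have haκ : #(range a) < κ := mk_range_le.trans_lt hA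
  have haE : R (range a) E (range (s 0)) := by
    have h1 := haR E (fun y hy => .inr (.inr hy))
    rw [union_eq_self_of_subset_left hCE] at h1
    refine hmon _ _ _ (B ∪ E ∪ C) haκ (hcount (countable_range _)) hE (hun (hun hB hE) hC) ?_
    rwa [union_eq_self_of_subset_left]
    rintro _ ⟨t, rfl⟩
    rcases hb t with h | h
    exacts [.inr h, .inl (.inl h)]
  let s' : ℕ → Set M := fun m => {y | ∃ i ≤ m, ∃ t, s i t = y}
  have hs' : ∀ m, s' (m + 1) = range (s (m + 1)) ∪ s' m := by
    intro m
    ext y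
    simp only [s', Nat.le_succ_iff, or_and_right, exists_or, mem_union, mem_range, mem_ofPred_eq,
      exists_eq_left]
    exact or_comm
  have hs'κ : ∀ m, #(s' m) < κ := fun m => hcount ((countable_range
    fun p : ℕ × Fin n => s p.1 p.2).mono (by rintro _ ⟨i, -, t, rfl⟩; exact ⟨(i, t), rfl⟩))
  have key : ∀ m, ∃ c : A → M, R (range c) E (s' m) ∧ SameType L E c a ∧
      ∀ i ≤ m, φ.Realize (Sum.elim c (s i)) := by
    intro m
    induction m with
    | zero =>
      refine ⟨a, ?_, .refl a, fun i hi => ?_⟩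
      · rwa [show s' 0 = range (s 0) by ext; simp [s'] ]
      · obtain rfl := Nat.le_zero.1 hi
        exact (ha.realize_iff φ hb).2 hφ
    | succ m ih =>
      obtain ⟨c, hcR, hca, hcφ⟩ := ih
      obtain ⟨σ, hσE, hσ⟩ := hM.exists_automorphism_fixing hE (hx.sameType_acl_range 0 (m + 1))
      have hσa : SameType L E (σ ∘ a) a := sameType_automorphism_fixing σ hσE a
      have hσR : R (range (σ ∘ a)) E (range (s (m + 1))) := by
        have := hinv.automorphism σ haκ hE (hcount (countable_range _)) haE
        rwa [← range_comp, ← range_comp, show σ ∘ s 0 = s (m + 1) from funext hσ,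
          show σ '' E = E from (image_congr hσE).trans (image_id' E)] at this
      have hσφ : φ.Realize (Sum.elim (σ ∘ a) (s (m + 1))) := by
        rw [← show σ ∘ s 0 = s (m + 1) from funext hσ, ← Sum.comp_elim,
          Language.StrongHomClass.realize_formula]
        exact (ha.realize_iff φ hb).2 hφ
      obtain ⟨d, hdR, hd₁, hd₂, -⟩ := ham E hE (aclClosed_acl _) A (σ ∘ a) c (range (s (m + 1)))
        (s' m) hA (hcount (countable_range _)) (hs'κ m) (hσa.trans hca.symm)
        (hx.coheirIndep m) hσR hcR
      refine ⟨d, by rwa [hs'], (hd₁.mono subset_union_left).trans hσa, fun i hi => ?_⟩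
      rcases Nat.le_succ_iff.1 hi with hi | rfl
      · exact (hd₂.realize_iff φ fun t => .inr ⟨i, hi, t, rfl⟩).2 (hcφ i hi)
      · exact (hd₁.realize_iff φ fun t => .inr (mem_range_self t)).2 hσφ
  refine hno (hM.exists_forall_mem (C := range fun p : ℕ × Fin n => s p.1 p.2)
    (hcount (countable_range _)) hA (T := fun i => {v | φ.Realize (Sum.elim v (s i))})
    (fun i => definable_setOf_realize φ fun t => ⟨(i, t), rfl⟩) fun F => ?_)
  obtain ⟨c, -, -, hc⟩ := key (F.sup id)
  exact ⟨c, fun i hi => hc i (Finset.le_sup (f := id) hi)⟩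

/-- If `tp(A / CB)` contains a formula implying a finite disjunction of formulas that divide over
`C`, then a realisation of `tp(A / CB)` which is `⫝^m`-independent also from the parameters of these
formulas satisfies one of them, although it is `⫝^d`-independent from the parameters. -/
lemma forkingIndep_of_monotonised {κ : Cardinal.{w}} (hM : IsMonster L M κ) {R : TernaryRel M}
    (hinv : Invariance L κ R) (hmon : Monotonicity κ R)
    (ham : ∀ E : Set M, #E < κ → AclClosed L E → AmalgamationOver L κ (coheirIndep L) R E)
    {A C B : Set M} (hA : #A < κ) (hC : #C < κ) (hB : #B < κ)
    (hext : ExtensionOver L κ (monotonised R) C) (h : monotonised R A C B) :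
    forkingIndep L A C B := by
  rintro n φ b hb hφ ⟨k, m, ψ, d, hdiv, himp⟩
  let D : Set M := range fun p : Σ j, Fin (m j) => d p.1 p.2
  have hD : #D < κ := (countable_range _).le_aleph0.trans_lt hM.aleph0_lt
  obtain ⟨a, ha, haR⟩ := hext A B D hA hB hD h
  obtain ⟨j, hj⟩ := himp a ((ha.realize_iff φ hb).2 hφ)
  have hBD : #(B ∪ D : Set M) < κ :=
    (mk_union_le _ _).trans_lt (Cardinal.add_lt_of_lt hM.aleph0_lt.le hB hD)
  have hdI := dividingIndep_of_monotonised hM hinv hmon ham (mk_range_le.trans_lt hA) hC hBD hext haR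
  refine hdI (m j) ((ψ j).relabel (Sum.map (rangeFactorization a) id)) (d j)
    (fun i => .inr (.inr ⟨⟨j, i⟩, rfl⟩)) ?_ ?_
  · rw [Language.Formula.realize_relabel, Sum.elim_comp_map]
    exact hj
  · obtain ⟨s, hs0, hs, hno⟩ := hdiv j
    refine ⟨s, hs0, hs, fun ⟨c, hc⟩ => hno ⟨c ∘ rangeFactorization a, fun i => ?_⟩⟩
    have := hc i
    rwa [Language.Formula.realize_relabel, Sum.elim_comp_map] at this

end Comparison

end ModelIndep

theorem mainTheorem5 {L : FirstOrder.Language.{u, v}} {M : Type w} [L.Structure M]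
    (κ : Cardinal.{w}) (hM : ModelIndep.IsMonster L M κ)
    (R : ModelIndep.TernaryRel M)
    (hweak : ∀ A C B : Set M, #A < κ → #C < κ → #B < κ →
      ModelIndep.dividingIndep L A C B → R A C B)
    (hinv : ModelIndep.Invariance L κ R)
    (hmon : ModelIndep.Monotonicity κ R)
    (ham : ∀ E : Set M, #E < κ → ModelIndep.AclClosed L E →
      ModelIndep.AmalgamationOver L κ (ModelIndep.coheirIndep L) R E) :
    ((∀ C : Set M, #C < κ → ModelIndep.AclClosed L C →
        ModelIndep.ExtensionOver L κ (ModelIndep.monotonised R) C) →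
      ∀ A C B : Set M, #A < κ → #C < κ → #B < κ → ModelIndep.AclClosed L C →
        (ModelIndep.monotonised R A C B ↔ ModelIndep.forkingIndep L A C B) ∧
        (ModelIndep.forkingIndep L A C B ↔ ModelIndep.dividingIndep L A C B)) ∧
    ((∀ C : Set M, #C < κ →
        ModelIndep.ExtensionOver L κ (ModelIndep.monotonised R) C) →
      ∀ A C B : Set M, #A < κ → #C < κ → #B < κ →
        (ModelIndep.monotonised R A C B ↔ ModelIndep.forkingIndep L A C B) ∧
        (ModelIndep.forkingIndep L A C B ↔ ModelIndep.dividingIndep L A C B)) := by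
  have key : ∀ A C B : Set M, #A < κ → #C < κ → #B < κ →
      ModelIndep.ExtensionOver L κ (ModelIndep.monotonised R) C →
      (ModelIndep.monotonised R A C B ↔ ModelIndep.forkingIndep L A C B) ∧
      (ModelIndep.forkingIndep L A C B ↔ ModelIndep.dividingIndep L A C B) := by
    intro A C B hA hC hB hext
    have hdm : ModelIndep.dividingIndep L A C B → ModelIndep.monotonised R A C B :=
      ModelIndep.monotonised_of_dividingIndep hM hweak hA hC hB
    have hmf : ModelIndep.monotonised R A C B → ModelIndep.forkingIndep L A C B :=
      ModelIndep.forkingIndep_of_monotonised hM hinv hmon ham hA hC hB hext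
    have hfd : ModelIndep.forkingIndep L A C B → ModelIndep.dividingIndep L A C B :=
      ModelIndep.dividingIndep_of_forkingIndep
    exact ⟨⟨hmf, fun h => hdm (hfd h)⟩, ⟨hfd, fun h => hmf (hdm h)⟩⟩
  exact ⟨fun hext A C B hA hC hB hacl => key A C B hA hC hB (hext C hC hacl),
    fun hext A C B hA hC hB => key A C B hA hC hB (hext C hC)⟩
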